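/- **Setting.** There are $N$ firms and a consumer who wants to predict $y=f(x)+\epsilon$, where $f:\mathbb R^k\to\mathbb R$ is a random (jointly measurable) function drawn from a prior $F$, $x\sim G$, and $\epsilon$ has mean zero and variance $\sigma^2<\infty$; $f,x,\epsilon$ are independent. Each firm $i$ has a dataset $D^{(i)}$ of $n$ data points $(x_j,f(x_j)+\epsilon_j)$ with $x_j\sim G$ and $\epsilon_j$ distributed like $\epsilon$, all drawn independently given $f$ (across points and firms, and independently of $(x,\epsilon)$). A model is a measurable function $M$ of $(x,D)$ with values in $\mathbb R$. Each firm has chosen a model $M_i\in\mathcal M_i$, with entry cost $c(M_i)>0$, or has not entered ($M_i=\emptyset$). Let $\mathbf M=(M_i)_i$, let $E=E(\mathbf M)$ be the set of entrants, and assume that every entrant's model has finite mean squared error $\mathbb E[(M_i(x,D^{(i)})-y)^2]$. For nonempty $E'\subseteq E$ let $$U(E',\mathbf M)=\max_{w\in\mathbb R_+^{E'},\ \sum_{i\in E'} w_i=1}\ -\mathbb E\Big[\Big(\sum_{i\in E'}w_iM_i(x,D^{(i)})-y\Big)^2\Big],$$ and let $U(\emptyset,\mathbf M)=\underline u<0$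 be the value of the outside option. **Pricing subgame.** Given $\mathbf M$, the entrants simultaneously set prices $p_i\in\mathbb R$. The consumer observes the prices, and chooses a set $P\subseteq E$ of models to buy and nonnegative weights on $P$ summing to one (no weights if $P=\emptyset$). Her payoff is minus the expected squared error of the weighted prediction (or $\underline u$ if $P=\emptyset$) minus $\sum_{i\in P}p_i$. Entrant $i$ gets $p_i\mathbf 1\{i\in P\}-c(M_i)$. The solution concept is subgame perfect Nash equilibrium (SPNE), possibly in mixed strategies. Consider the system $$p_i=\min_{E'\subseteq E\setminus\{i\}}\Big[U(E,\mathbf M)-U(E',\mathbf M)-\sum_{j\in E\setminus E',\,j\neq i}p_j\Big]\qquad\text{for all } i\in E.\tag{$*$}$$ **Proposition.** 1. If $U(E,\mathbf M)\ge\underline u$, then $(*)$ has a solution $p$ with $p\ge 0$ for which the pricing subgame has a (pure-strategy) SPNE in which firms charge $p$ and the consumer buys all models in $E$. 2. If $U(\{i\},\mathbf M)\ge\underline u$ for every $i\in E$, then every solution $p$ of $(*)$ is nonnegative, and for every such $p$ the pricing subgame has a (pure-strategy) SPNE in which firms charge $p$ and the consumer buys all models in $E$. 3. In every SPNE of the pricing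 subgame in which the consumer buys all models in $E$ (with probability one), the prices satisfy $(*)$ (with probability one). -/

import Mathlib

open MeasureTheory ProbabilityTheory

namespace ModelMarket

/-- Vectors of covariates. -/
abbrev Covariates (k : ℕ) : Type := EuclideanSpace ℝ (Fin k)

/-- A dataset: `n` data points `(x_j, y_j)` in `ℝ^k × ℝ`. -/
abbrev Dataset (k n : ℕ) : Type := Fin n → Covariates k × ℝ

/-- A model: a measurable function of a covariate vector and a dataset. -/
abbrev Model (k n : ℕ) : Type := {m : Covariates k × Dataset k n → ℝ // Measurable m}

/-- The primitives of the market with `N` firms. The random regression function is `f θ`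
with `θ` drawn from `priorF`; covariates have law `lawG`; errors have law `noise`. -/
structure Market (k n N : ℕ) (Θ : Type*) [MeasurableSpace Θ] where
  /-- law of the parameter that determines the true function -/
  priorF : ProbabilityMeasure Θ
  /-- the true function, given the parameter -/
  f : Θ → Covariates k → ℝ
  measurable_f : Measurable (Function.uncurry f)
  /-- law of the covariates -/
  lawG : ProbabilityMeasure (Covariates k)
  /-- law of the error term -/
  noise : ProbabilityMeasure ℝ
  /-- standard deviation of the error term -/
  sigma : ℝ
  noise_memLp : MemLp (fun e : ℝ => e) 2 (noise : Measure ℝ)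
  noise_mean : ∫ e, e ∂(noise : Measure ℝ) = 0
  noise_variance : Var[fun e : ℝ => e; (noise : Measure ℝ)] = sigma ^ 2
  /-- models available to each firm -/
  available : Fin N → Set (Model k n)
  /-- entry costs -/
  cost : Model k n → ℝ
  cost_pos : ∀ i, ∀ m ∈ available i, 0 < cost m
  /-- the consumer's utility from not buying any model -/
  outside : ℝ
  outside_neg : outside < 0

/-- All the uncertainty: the parameter of the true function, the covariates `x` and the error
`ε` of the consumer's problem, and, for each firm and each of its data points, the covariates
and the error of that data point. -/
abbrev Sample (k n N : ℕ) (Θ : Type*) : Type _ :=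
  Θ × Covariates k × ℝ × (Fin N → Fin n → Covariates k × ℝ)

noncomputable section

namespace Market

variable {k n N : ℕ} {Θ : Type*} [MeasurableSpace Θ] (S : Market k n N Θ)

/-- The common prior: all components are independent. In particular the datasets of the firms are
independent conditionally on the true function. -/
def law : Measure (Sample k n N Θ) :=
  (S.priorF : Measure Θ).prod ((S.lawG : Measure (Covariates k)).prod
    ((S.noise : Measure ℝ).prod
      (Measure.pi fun _ : Fin N => Measure.pi fun _ : Fin n =>
        (S.lawG : Measure (Covariates k)).prod (S.noise : Measure ℝ))))

/-- The outcome `y = f(x) + ε` that the consumer wants to predict. -/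
def outcome (s : Sample k n N Θ) : ℝ := S.f s.1 s.2.1 + s.2.2.1

/-- The dataset of firm `i`, with data points `(x_j, f(x_j) + ε_j)`. -/
def dataset (i : Fin N) (s : Sample k n N Θ) : Dataset k n :=
  fun j => ((s.2.2.2 i j).1, S.f s.1 (s.2.2.2 i j).1 + (s.2.2.2 i j).2)

/-- A profile of actions of the first stage: each firm chooses one of its available models, or
`none`, which is not to enter. -/
abbrev Profile : Type := ∀ i : Fin N, Option (S.available i)

variable {S}

/-- The set of entrants. -/
abbrev Entrant (M : S.Profile) : Type := {i : Fin N // (M i).isSome}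

/-- The model of an entrant. -/
def model (M : S.Profile) (i : Entrant M) : Model k n := ((M i.1).get i.2).1

/-- The prediction that entrant `i` delivers, as a random variable. -/
def prediction (M : S.Profile) (i : Entrant M) (s : Sample k n N Θ) : ℝ :=
  (model M i).1 (s.2.1, S.dataset i.1 s)

/-- Mean squared error of the weighted average of the predictions of the models in `P`. -/
def mse (M : S.Profile) (P : Finset (Entrant M)) (w : P → ℝ) : ℝ :=
  ∫ s, ((∑ j : P, w j * prediction M j.1 s) - S.outcome s) ^ 2 ∂S.law

/-- Each model on sale has a finite mean squared error. -/
def FiniteMSE (M : S.Profile) : Prop :=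
  ∀ i : Entrant M, Integrable (fun s => (prediction M i s - S.outcome s) ^ 2) S.law

/-- `U(P, M)`: negative of the mean squared error when the models in `P` are weighted optimally,
and the outside option when `P` is empty. -/
def U (M : S.Profile) (P : Finset (Entrant M)) : ℝ :=
  if P = ∅ then S.outside else sSup ((fun w : P → ℝ => -mse M P w) '' stdSimplex ℝ P)

/-- A choice of the consumer: which models to buy, and weights for the models bought, which are
nonnegative and sum to one as soon as some model is bought. -/
abbrev Choice (M : S.Profile) : Type :=
  Σ P : Finset (Entrant M), {w : P → ℝ // (∀ j, 0 ≤ w j) ∧ (P.Nonempty → ∑ j, w j = 1)}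

/-- The consumer's expected payoff from a choice at given prices. -/
def consumerPayoff (M : S.Profile) (p : Entrant M → ℝ) (c : Choice M) : ℝ :=
  (if c.1 = ∅ then S.outside else -mse M c.1 c.2.1) - ∑ j ∈ c.1, p j

/-- A profile of (possibly mixed) strategies in the subgame that starts at the pricing stage after
the model choices `M`. Entrants draw their prices independently; the consumer observes the prices
and then draws her choice. The last field says that the firms' expected profits are defined. -/
structure StrategyProfile (M : S.Profile) where
  price : Entrant M → ProbabilityMeasure ℝ
  consumer : (Entrant M → ℝ) → ProbabilityMeasure (Choice M)
  aemeasurable_sale : ∀ (i : Entrant M) (x : ℝ),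
    AEMeasurable
      (fun p => (consumer (Function.update p i x) : Measure (Choice M)).real {c | i ∈ c.1})
      (Measure.pi fun j => (price j : Measure ℝ))

namespace StrategyProfile

variable {M : S.Profile} (τ : StrategyProfile M)

/-- Joint law of the prices. -/
def priceLaw : Measure (Entrant M → ℝ) := Measure.pi fun j => (τ.price j : Measure ℝ)

/-- Expected profit of firm `i` when it charges `x` and all others play according to `τ`: the
expectation of `x` times the indicator of a sale, minus the entry cost. -/
def profit (i : Entrant M) (x : ℝ) : ℝ :=
  (∫ p, x * (τ.consumer (Function.update p i x) : Measure (Choice M)).real {c | i ∈ c.1}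
    ∂τ.priceLaw) - S.cost (model M i)

/-- Subgame perfect Nash equilibrium of the pricing subgame: after every vector of prices the
consumer's choice is optimal (with probability one), and each firm only uses prices that are best
responses (with probability one). -/
def IsSPNE : Prop :=
  (∀ p : Entrant M → ℝ, ∀ᵐ c ∂(τ.consumer p : Measure (Choice M)),
    ∀ c' : Choice M, consumerPayoff M p c' ≤ consumerPayoff M p c) ∧
  (∀ i : Entrant M, ∀ᵐ x ∂(τ.price i : Measure ℝ), ∀ x' : ℝ, τ.profit i x' ≤ τ.profit i x)

/-- On the path of play the consumer buys all models (with probability one). -/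
def BuysAll : Prop :=
  ∀ᵐ p ∂τ.priceLaw, ∀ᵐ c ∂(τ.consumer p : Measure (Choice M)), c.1 = Finset.univ

/-- The strategies are pure, and the firms charge the prices `p`. -/
def IsPureWithPrices (p : Entrant M → ℝ) : Prop :=
  (∀ i, (τ.price i : Measure ℝ) = Measure.dirac (p i)) ∧
  (∀ q, ∃ c : Choice M, (τ.consumer q : Measure (Choice M)) = Measure.dirac c)

end StrategyProfile

/-- The fixed-point system for the prices. -/
def SolvesPriceSystem (M : S.Profile) (p : Entrant M → ℝ) : Prop :=
  ∀ i : Entrant M,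
    p i = (Finset.univ.erase i).powerset.inf' (Finset.powerset_nonempty _) fun E' =>
      U M Finset.univ - U M E' - ∑ j ∈ (Finset.univ \ E').erase i, p j

end Market

end

end ModelMarket

/-! By `eq_inf'_iff`, the price system says that the full set maximizes `netValue` and that, for
each `i`, some maximizer omits `i`. The first property lets the consumer buy everything; the second
blocks price increases, as a dearer `i` loses to the maximizer that omits it. Unsold firms earn zero
before entry costs, so nonnegative solutions are equilibrium prices
(`SolvesPriceSystem.exists_isSPNE`). Such solutions come from maximizing total price in
`exists_prices`. If `U` is also monotone from the empty set, `prices_nonneg` shows that every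
solution is nonnegative. Conversely, sure sale makes profit equal to price minus cost, so mixing
collapses to one price vector. If no maximizer omitted `i`, firm `i` could raise its price slightly
and still sell. -/

namespace ModelMarket

/-! ### Prices and optimal bundles for an abstract set function. -/

section Combinatorics

variable {ι : Type*} [Fintype ι] [DecidableEq ι]

/-- The value of a set of goods, net of what it costs. -/
def netValue (V : Finset ι → ℝ) (p : ι → ℝ) (A : Finset ι) : ℝ := V A - ∑ j ∈ A, p j

theorem sum_sdiff_erase (p : ι → ℝ) {i : ι} {A : Finset ι} (hi : i ∉ A) :
    ∑ j ∈ (Finset.univ \ A).erase i, p j = ∑ j, p j - ∑ j ∈ A, p j - p i := by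
  have h₁ := Finset.sum_sdiff (f := p) (Finset.subset_univ A)
  have h₂ := Finset.add_sum_erase (Finset.univ \ A) p (a := i) (by simp [hi])
  linarith

/-- The price system says that the full set is optimal among the sets that miss some good, and
that each good is missing from some optimal set. -/
theorem eq_inf'_iff (V : Finset ι → ℝ) (p : ι → ℝ) (i : ι) :
    (p i = (Finset.univ.erase i).powerset.inf' (Finset.powerset_nonempty _) fun A =>
      V Finset.univ - V A - ∑ j ∈ (Finset.univ \ A).erase i, p j) ↔
    (∀ A, i ∉ A → netValue V p A ≤ netValue V p Finset.univ) ∧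
      ∃ A, i ∉ A ∧ netValue V p A = netValue V p Finset.univ := by
  have hmem : ∀ A : Finset ι, A ∈ (Finset.univ.erase i).powerset ↔ i ∉ A := by
    intro A
    rw [Finset.mem_powerset, Finset.subset_erase]
    simp
  constructor
  · intro h
    constructor
    · intro A hA
      have := Finset.inf'_le (fun A => V Finset.univ - V A - ∑ j ∈ (Finset.univ \ A).erase i, p j)
        ((hmem A).2 hA)
      rw [← h] at this
      simp only [sum_sdiff_erase p hA] at this
      unfold netValue
      linarith
    · obtain ⟨A, hA, hAe⟩ := Finset.exists_mem_eq_inf' (Finset.powerset_nonempty _)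
        (fun A => V Finset.univ - V A - ∑ j ∈ (Finset.univ \ A).erase i, p j)
      have hA' := (hmem A).1 hA
      refine ⟨A, hA', ?_⟩
      rw [← h] at hAe
      simp only [sum_sdiff_erase p hA'] at hAe
      unfold netValue
      linarith
  · rintro ⟨hle, A, hA, hAe⟩
    apply le_antisymm
    · refine Finset.le_inf' _ _ fun B hB => ?_
      have hB' := (hmem B).1 hB
      have := hle B hB'
      rw [sum_sdiff_erase p hB']
      unfold netValue at this
      linarith
    · refine (Finset.inf'_le _ ((hmem A).2 hA)).trans ?_
      rw [sum_sdiff_erase p hA]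
      unfold netValue at hAe
      linarith

theorem netValue_update_of_notMem {ι : Type*} [DecidableEq ι] (V : Finset ι → ℝ) (p : ι → ℝ) {i : ι} (x : ℝ) {A : Finset ι}
    (hi : i ∉ A) : netValue V (Function.update p i x) A = netValue V p A := by
  unfold netValue
  rw [Finset.sum_update_of_notMem hi]

theorem netValue_update_of_mem {ι : Type*} [DecidableEq ι] (V : Finset ι → ℝ) (p : ι → ℝ) {i : ι} (x : ℝ) {A : Finset ι}
    (hi : i ∈ A) : netValue V (Function.update p i x) A = netValue V p A + p i - x := by
  unfold netValue
  have h := Finset.add_sum_erase A p hi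
  rw [Finset.sum_update_of_mem hi, Finset.sdiff_singleton_eq_erase]
  linarith

/-- Nonnegative prices that are maximal among those at which the full set is optimal solve the
price system. -/
theorem exists_prices (V : Finset ι → ℝ) (hV : ∀ A, V A ≤ V Finset.univ) :
    ∃ p : ι → ℝ, (∀ i, 0 ≤ p i) ∧ (∀ A, netValue V p A ≤ netValue V p Finset.univ) ∧
      ∀ i, ∃ A, i ∉ A ∧ netValue V p A = netValue V p Finset.univ := by
  have hcont : ∀ A, Continuous fun p : ι → ℝ => netValue V p A := by
    intro A
    unfold netValue
    fun_prop
  let K : Set (ι → ℝ) := {p | (∀ i, 0 ≤ p i) ∧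
    ∀ A, netValue V p A ≤ netValue V p Finset.univ}
  have hKclosed : IsClosed K := by
    have : K = (⋂ i, {p : ι → ℝ | 0 ≤ p i}) ∩
        ⋂ A, {p | netValue V p A ≤ netValue V p Finset.univ} := by
      ext p; simp [K]
    rw [this]
    exact (isClosed_iInter fun i => isClosed_le continuous_const (continuous_apply i)).inter
      (isClosed_iInter fun A => isClosed_le (hcont A) (hcont _))
  -- Comparing the full set with the full set minus `i` caps each price by a marginal value; this
  -- gives compactness.
  have hKsub : K ⊆ Set.Icc 0 fun i => V Finset.univ - V (Finset.univ.erase i) := by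
    rintro p ⟨h₀, h₁⟩
    refine ⟨h₀, fun i => ?_⟩
    have h₂ := h₁ (Finset.univ.erase i)
    have h₃ := Finset.add_sum_erase Finset.univ p (Finset.mem_univ i)
    unfold netValue at h₂
    simp only
    linarith
  have hK : IsCompact K := isCompact_Icc.of_isClosed_subset hKclosed hKsub
  have hne : K.Nonempty := ⟨0, fun _ => le_rfl, fun A => by simpa [netValue] using hV A⟩
  obtain ⟨p, ⟨h₀, h₁⟩, hmax⟩ := hK.exists_isMaxOn hne
    (f := fun p : ι → ℝ => ∑ i, p i) (by fun_prop)
  refine ⟨p, h₀, h₁, fun i => ?_⟩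
  by_contra! hi
  have hlt : ∀ A, i ∉ A → netValue V p A < netValue V p Finset.univ :=
    fun A hA => lt_of_le_of_ne (h₁ A) (hi A hA)
  obtain ⟨A₀, hA₀, hA₀max⟩ := Finset.exists_max_image (Finset.univ.filter fun A : Finset ι => i ∉ A)
    (netValue V p) ⟨∅, by simp⟩
  have hA₀i : i ∉ A₀ := by simpa using hA₀
  -- Raising `p i` by this slack lowers all sets containing `i` equally and only brings the full set
  -- level with the best set omitting `i`, so feasibility survives while total price grows.
  set δ := netValue V p Finset.univ - netValue V p A₀
  have hδ : 0 < δ := sub_pos.2 (hlt A₀ hA₀i)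
  have hmem : Function.update p i (p i + δ) ∈ K := by
    refine ⟨fun j => ?_, fun A => ?_⟩
    · rcases eq_or_ne j i with rfl | hj
      · rw [Function.update_self]; linarith [h₀ j]
      · rw [Function.update_of_ne hj]; exact h₀ j
    · rw [netValue_update_of_mem V p _ (Finset.mem_univ i)]
      by_cases hA : i ∈ A
      · rw [netValue_update_of_mem V p _ hA]
        linarith [h₁ A]
      · rw [netValue_update_of_notMem V p _ hA]
        have := hA₀max A (by simpa using hA)
        simp only [δ]
        linarith
  have h₂ : ∑ j, Function.update p i (p i + δ) j ≤ ∑ j, p j := hmax hmem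
  rw [Finset.sum_update_of_mem (Finset.mem_univ i), Finset.sdiff_singleton_eq_erase] at h₂
  have h₃ := Finset.add_sum_erase Finset.univ p (Finset.mem_univ i)
  linarith

/-- Adding `i` to an optimal set that omits it cannot raise net value, so `p i` is at least the
marginal value of `i` there. -/
theorem prices_nonneg (V : Finset ι → ℝ) (p : ι → ℝ)
    (hV : ∀ i A, V A ≤ V (insert i A))
    (hle : ∀ A, netValue V p A ≤ netValue V p Finset.univ) {i : ι}
    (hi : ∃ A, i ∉ A ∧ netValue V p A = netValue V p Finset.univ) : 0 ≤ p i := by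
  obtain ⟨A, hA, hAe⟩ := hi
  have h₁ := hle (insert i A)
  have h₂ := hV i A
  rw [← hAe] at h₁
  unfold netValue at h₁
  rw [Finset.sum_insert hA] at h₁
  linarith

end Combinatorics

theorem pi_dirac {ι : Type*} [Fintype ι] {X : ι → Type*} [∀ i, MeasurableSpace (X i)]
    (x : ∀ i, X i) : (Measure.pi fun i => Measure.dirac (x i)) = Measure.dirac x := by
  refine Measure.pi_eq fun s hs => ?_
  rw [Measure.dirac_apply' _ (MeasurableSet.univ_pi hs)]
  by_cases h : ∀ i, x i ∈ s i
  · rw [Set.indicator_of_mem (by simpa using h)]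
    exact (Finset.prod_eq_one fun i _ => by
      rw [Measure.dirac_apply' _ (hs i), Set.indicator_of_mem (h i), Pi.one_apply]).symm
  · rw [Set.indicator_of_notMem (by simpa using h)]
    push Not at h
    obtain ⟨i, hi⟩ := h
    exact (Finset.prod_eq_zero (Finset.mem_univ i) (by
      rw [Measure.dirac_apply' _ (hs i), Set.indicator_of_notMem hi])).symm

/-! ### Mean squared error and optimal weights. -/

namespace Market

variable {k n N : ℕ} {Θ : Type*} [MeasurableSpace Θ] {S : Market k n N Θ}

theorem measurable_outcome : Measurable S.outcome := by
  have h : Measurable fun s : Sample k n N Θ => S.f s.1 s.2.1 :=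
    S.measurable_f.comp (measurable_fst.prodMk measurable_snd.fst)
  exact h.add measurable_snd.snd.fst

theorem measurable_dataset (i : Fin N) : Measurable (S.dataset i) := by
  refine measurable_pi_lambda _ fun j => ?_
  have hd : Measurable fun s : Sample k n N Θ => s.2.2.2 i j :=
    (measurable_pi_apply j).comp ((measurable_pi_apply i).comp measurable_snd.snd.snd)
  have hf : Measurable fun s : Sample k n N Θ => S.f s.1 (s.2.2.2 i j).1 :=
    S.measurable_f.comp (measurable_fst.prodMk hd.fst)
  exact hd.fst.prodMk (hf.add hd.snd)

variable {M : S.Profile}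

theorem measurable_prediction (i : Entrant M) : Measurable (prediction M i) :=
  (model M i).2.comp (measurable_snd.fst.prodMk (measurable_dataset i.1))

theorem FiniteMSE.memLp (hM : FiniteMSE M) (i : Entrant M) :
    MemLp (fun s => prediction M i s - S.outcome s) 2 S.law :=
  (memLp_two_iff_integrable_sq
    ((measurable_prediction i).sub measurable_outcome).aestronglyMeasurable).2 (hM i)

theorem mse_nonneg (P : Finset (Entrant M)) (w : P → ℝ) : 0 ≤ mse M P w :=
  integral_nonneg fun _ => sq_nonneg _

/-- As weights sum to one, the error of the average is the average of the errors. Expanding the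
square gives a quadratic form in `w`, with cross terms integrable because errors are in L². -/
theorem mse_eq_sum (hM : FiniteMSE M) (P : Finset (Entrant M)) {w : P → ℝ} (hw : ∑ j, w j = 1) :
    mse M P w = ∑ a, ∑ b, w a * w b * ∫ s, (prediction M a.1 s - S.outcome s) *
      (prediction M b.1 s - S.outcome s) ∂S.law := by
  have hint : ∀ a b : P, Integrable (fun s => w a * w b * ((prediction M a.1 s - S.outcome s) *
      (prediction M b.1 s - S.outcome s))) S.law := fun a b =>
    ((hM.memLp a.1).integrable_mul (hM.memLp b.1)).const_mul _
  have hsq : ∀ s, ((∑ j : P, w j * prediction M j.1 s) - S.outcome s) ^ 2 =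
      ∑ a, ∑ b, w a * w b * ((prediction M a.1 s - S.outcome s) *
      (prediction M b.1 s - S.outcome s)) := by
    intro s
    have h : (∑ j : P, w j * prediction M j.1 s) - S.outcome s =
        ∑ j : P, w j * (prediction M j.1 s - S.outcome s) := by
      simp only [mul_sub, Finset.sum_sub_distrib, ← Finset.sum_mul, hw, one_mul]
    rw [h, sq, Finset.sum_mul_sum]
    exact Finset.sum_congr rfl fun a _ => Finset.sum_congr rfl fun b _ => by ring
  unfold mse
  simp_rw [hsq]
  rw [integral_finsetSum _ fun a _ => integrable_finsetSum _ fun b _ => hint a b]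
  refine Finset.sum_congr rfl fun a _ => ?_
  rw [integral_finsetSum _ fun b _ => hint a b]
  exact Finset.sum_congr rfl fun b _ => integral_const_mul _ _

theorem continuousOn_mse (hM : FiniteMSE M) (P : Finset (Entrant M)) :
    ContinuousOn (mse M P) (stdSimplex ℝ P) := by
  refine ContinuousOn.congr (f := fun w => ∑ a, ∑ b, w a * w b *
    ∫ s, (prediction M a.1 s - S.outcome s) * (prediction M b.1 s - S.outcome s) ∂S.law) ?_
    fun w hw => mse_eq_sum hM P hw.2
  fun_prop

theorem bddAbove_image_neg_mse (P : Finset (Entrant M)) :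
    BddAbove ((fun w : P → ℝ => -mse M P w) '' stdSimplex ℝ P) :=
  ⟨0, by rintro _ ⟨w, -, rfl⟩; exact neg_nonpos.2 (mse_nonneg P w)⟩

theorem neg_mse_le_U {P : Finset (Entrant M)} (hP : P.Nonempty) {w : P → ℝ}
    (hw : w ∈ stdSimplex ℝ P) : -mse M P w ≤ U M P := by
  unfold U
  rw [if_neg hP.ne_empty]
  exact le_csSup (bddAbove_image_neg_mse P) ⟨w, hw, rfl⟩

theorem exists_neg_mse_eq_U (hM : FiniteMSE M) {P : Finset (Entrant M)} (hP : P.Nonempty) :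
    ∃ w ∈ stdSimplex ℝ P, -mse M P w = U M P := by
  obtain ⟨i, hi⟩ := hP
  obtain ⟨w, hw, hwe⟩ := (isCompact_stdSimplex ℝ P).exists_sSup_image_eq
    ⟨_, single_mem_stdSimplex ℝ (⟨i, hi⟩ : P)⟩ (continuousOn_mse hM P).neg
  refine ⟨w, hw, ?_⟩
  unfold U
  rw [if_neg (Finset.ne_empty_of_mem hi)]
  exact hwe.symm

/-- The models in a larger set do at least as well, as weights may be zero. -/
theorem U_mono (hM : FiniteMSE M) {P Q : Finset (Entrant M)} (hP : P.Nonempty) (hPQ : P ⊆ Q) :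
    U M P ≤ U M Q := by
  classical
  obtain ⟨w, hw, hwe⟩ := exists_neg_mse_eq_U hM hP
  let W : Entrant M → ℝ := fun j => if h : j ∈ P then w ⟨j, h⟩ else 0
  have hsum : ∀ g : Entrant M → ℝ, ∑ j : Q, W j * g j = ∑ j : P, w j * g j := by
    intro g
    rw [Finset.sum_coe_sort Q fun j => W j * g j,
      ← Finset.sum_subset hPQ fun j _ hj => by simp [W, hj],
      ← Finset.sum_coe_sort P fun j => W j * g j]
    exact Finset.sum_congr rfl fun j _ => by simp [W]
  have hmse : mse M Q (fun j => W j) = mse M P w :=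
    integral_congr_ae (.of_forall fun s =>
      congrArg (fun t => (t - S.outcome s) ^ 2) (hsum fun j => prediction M j s))
  rw [← hwe, ← hmse]
  refine neg_mse_le_U (hP.mono hPQ) ⟨fun j => ?_, ?_⟩
  · change 0 ≤ (if h : j.1 ∈ P then w ⟨j.1, h⟩ else 0)
    split_ifs
    · exact hw.1 _
    · exact le_rfl
  · have h := hsum fun _ => 1
    simp only [mul_one] at h
    exact h.trans hw.2

/-! ### The consumer's optimal choices. -/

theorem consumerPayoff_le (p : Entrant M → ℝ) (c : Choice M) :
    consumerPayoff M p c ≤ netValue (U M) p c.1 := by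
  obtain ⟨P, w, h₀, h₁⟩ := c
  unfold consumerPayoff netValue
  refine sub_le_sub_right ?_ _
  rcases P.eq_empty_or_nonempty with rfl | hP
  · simp [U]
  · rw [if_neg hP.ne_empty]
    exact neg_mse_le_U hP ⟨h₀, h₁ hP⟩

theorem exists_consumerPayoff_eq (hM : FiniteMSE M) (P : Finset (Entrant M)) :
    ∃ c : Choice M, c.1 = P ∧ ∀ p, consumerPayoff M p c = netValue (U M) p P := by
  rcases P.eq_empty_or_nonempty with rfl | hP
  · exact ⟨⟨∅, 0, fun _ => le_rfl, fun h => absurd h (by simp)⟩, rfl,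
      fun p => by simp [consumerPayoff, netValue, U]⟩
  · obtain ⟨w, hw, hwe⟩ := exists_neg_mse_eq_U hM hP
    refine ⟨⟨P, w, hw.1, fun _ => hw.2⟩, rfl, fun p => ?_⟩
    simp [consumerPayoff, netValue, hP.ne_empty, hwe]

/-- A choice is optimal only if the set bought is worth its price most. -/
theorem netValue_le_of_optimal (hM : FiniteMSE M) {p : Entrant M → ℝ} {c : Choice M}
    (hc : ∀ c' : Choice M, consumerPayoff M p c' ≤ consumerPayoff M p c)
    (A : Finset (Entrant M)) : netValue (U M) p A ≤ netValue (U M) p c.1 := by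
  obtain ⟨c', -, hc'⟩ := exists_consumerPayoff_eq hM A
  rw [← hc' p]
  exact (hc c').trans (consumerPayoff_le p c)

theorem exists_optimal (hM : FiniteMSE M) (p : Entrant M → ℝ) {P : Finset (Entrant M)}
    (hP : ∀ A, netValue (U M) p A ≤ netValue (U M) p P) :
    ∃ c : Choice M, c.1 = P ∧ ∀ c' : Choice M, consumerPayoff M p c' ≤ consumerPayoff M p c := by
  obtain ⟨c, hc, hce⟩ := exists_consumerPayoff_eq hM P
  refine ⟨c, hc, fun c' => ?_⟩
  rw [hce p]
  exact (consumerPayoff_le p c').trans (hP _)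

/-- Measurability in a sigma type is checked on each fibre, and here each fibre is contained
entirely or not at all. -/
theorem measurableSet_choice (A : Set (Finset (Entrant M))) :
    MeasurableSet {c : Choice M | c.1 ∈ A} := by
  refine MeasurableSpace.measurableSet_iInf.2 fun P => ?_
  exact MeasurableSpace.map_def.2 (MeasurableSet.const (P ∈ A))

instance : MeasurableSingletonClass (Choice M) where
  measurableSet_singleton c := by
    refine MeasurableSpace.measurableSet_iInf.2 fun P => ?_
    refine MeasurableSpace.map_def.2 (Set.Subsingleton.measurableSet fun a ha b hb => ?_)
    have h : (⟨P, a⟩ : Choice M) = ⟨P, b⟩ :=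
      (Set.mem_singleton_iff.1 ha).trans (Set.mem_singleton_iff.1 hb).symm
    exact eq_of_heq (Sigma.mk.inj h).2

theorem solvesPriceSystem_iff (p : Entrant M → ℝ) :
    SolvesPriceSystem M p ↔ ∀ i,
      (∀ A, i ∉ A → netValue (U M) p A ≤ netValue (U M) p Finset.univ) ∧
        ∃ A, i ∉ A ∧ netValue (U M) p A = netValue (U M) p Finset.univ :=
  forall_congr' fun i => eq_inf'_iff (U M) p i

theorem SolvesPriceSystem.netValue_le {p : Entrant M → ℝ} (hp : SolvesPriceSystem M p)
    (A : Finset (Entrant M)) : netValue (U M) p A ≤ netValue (U M) p Finset.univ := by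
  by_cases hA : ∃ i, i ∉ A
  · obtain ⟨i, hi⟩ := hA
    exact ((solvesPriceSystem_iff p).1 hp i).1 A hi
  · push Not at hA
    rw [Finset.eq_univ_iff_forall.2 hA]

/-! ### Sufficiency: equilibria from nonnegative solutions. -/

/-- Nonnegative solutions of the price system are equilibrium prices. -/
theorem SolvesPriceSystem.exists_isSPNE (hM : FiniteMSE M) {p : Entrant M → ℝ}
    (hp : SolvesPriceSystem M p) (h₀ : ∀ i, 0 ≤ p i) :
    ∃ τ : StrategyProfile M, τ.IsPureWithPrices p ∧ τ.IsSPNE ∧ τ.BuysAll := by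
  classical
  -- Ties are broken for the full set at `p` itself; at other prices any optimal choice will do.
  have hchoice : ∀ q : Entrant M → ℝ, ∃ c : Choice M, (q = p → c.1 = Finset.univ) ∧
      ∀ c' : Choice M, consumerPayoff M q c' ≤ consumerPayoff M q c := by
    intro q
    rcases eq_or_ne q p with rfl | hq
    · obtain ⟨c, hc, hc'⟩ := exists_optimal hM q hp.netValue_le
      exact ⟨c, fun _ => hc, hc'⟩
    · obtain ⟨P, -, hP⟩ := Finset.exists_max_image Finset.univ (netValue (U M) q)
        Finset.univ_nonempty
      obtain ⟨c, -, hc⟩ := exists_optimal hM q fun A => hP A (Finset.mem_univ _)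
      exact ⟨c, fun h => absurd h hq, hc⟩
  choose d hd hopt using hchoice
  let τ : StrategyProfile M :=
    { price := fun i => ⟨Measure.dirac (p i), inferInstance⟩
      consumer := fun q => ⟨Measure.dirac (d q), inferInstance⟩
      aemeasurable_sale := fun i x => by
        have h : (Measure.pi fun j => Measure.dirac (p j)) = Measure.dirac p :=
          pi_dirac p
        simp only [ProbabilityMeasure.coe_mk, h]
        exact aemeasurable_dirac }
  have hlaw : τ.priceLaw = Measure.dirac p := pi_dirac p
  have hprofit : ∀ i x, τ.profit i x =
      (if i ∈ (d (Function.update p i x)).1 then x else 0) - S.cost (model M i) := by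
    intro i x
    unfold StrategyProfile.profit
    rw [hlaw, integral_dirac]
    congr 1
    simp only [τ, ProbabilityMeasure.coe_mk, measureReal_def]
    have h := Measure.dirac_apply' (d (Function.update p i x)) (measurableSet_choice {P | i ∈ P})
    simp only [Set.mem_ofPred_eq] at h
    rw [h]
    by_cases hi : i ∈ (d (Function.update p i x)).1 <;> simp [hi]
  refine ⟨τ, ⟨fun i => rfl, fun q => ⟨d q, rfl⟩⟩, ⟨fun q => ?_, fun i => ?_⟩, ?_⟩
  · change ∀ᵐ c ∂(Measure.dirac (d q)), _
    rw [ae_dirac_eq]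
    exact hopt q
  · change ∀ᵐ x ∂(Measure.dirac (p i)), _
    rw [ae_dirac_eq]
    change ∀ x', τ.profit i x' ≤ τ.profit i (p i)
    intro x
    rw [hprofit, hprofit, Function.update_eq_self,
      if_pos (show i ∈ (d p).1 by rw [hd p rfl]; exact Finset.mem_univ i)]
    refine sub_le_sub_right ?_ _
    split_ifs with hi
    -- After an increase, an optimal set `A` omitting `i` keeps its net value, while every set
    -- containing `i` falls strictly below it.
    · by_contra! hx
      obtain ⟨A, hA, hAe⟩ := ((solvesPriceSystem_iff p).1 hp i).2
      have h₁ := netValue_le_of_optimal hM (hopt (Function.update p i x)) A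
      rw [netValue_update_of_notMem _ _ _ hA, netValue_update_of_mem _ _ _ hi, hAe] at h₁
      have h₂ := hp.netValue_le (d (Function.update p i x)).1
      linarith
    -- A deviation without a sale has zero revenue; nonnegativity of `p i` rules it out.
    · exact h₀ i
  · unfold StrategyProfile.BuysAll
    rw [hlaw, ae_dirac_eq]
    change ∀ᵐ c ∂(Measure.dirac (d p)), _
    rw [ae_dirac_eq]
    exact hd p rfl

end Market

/-! ### Necessity: equilibria in which everything is sold. -/

/-- Replacing one coordinate of a random vector with independent coordinates by an independent
copy does not change its law. -/
theorem measurePreserving_update {ι : Type*} [Fintype ι] [DecidableEq ι] {X : ι → Type*}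
    [∀ i, MeasurableSpace (X i)] (μ : ∀ i, Measure (X i)) [∀ i, IsProbabilityMeasure (μ i)]
    (i : ι) :
    MeasurePreserving (fun q : X i × (∀ j, X j) => Function.update q.2 i q.1)
      ((μ i).prod (Measure.pi μ)) (Measure.pi μ) := by
  have hmeas : Measurable fun q : X i × (∀ j, X j) => Function.update q.2 i q.1 := by
    refine measurable_pi_lambda _ fun j => ?_
    rcases eq_or_ne j i with rfl | hj
    · simpa using measurable_fst
    · simp only [Function.update_of_ne hj]
      exact (measurable_pi_apply j).comp measurable_snd
  refine ⟨hmeas, (Measure.pi_eq fun s hs => ?_).symm⟩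
  rw [Measure.map_apply hmeas (MeasurableSet.univ_pi hs)]
  have hpre : (fun q : X i × (∀ j, X j) => Function.update q.2 i q.1) ⁻¹' Set.univ.pi s =
      s i ×ˢ Set.univ.pi (Function.update s i Set.univ) := by
    ext ⟨x, p⟩
    simp only [Set.mem_preimage, Set.mem_pi, Set.mem_univ, true_implies, Set.mem_prod]
    constructor
    · intro h
      refine ⟨by simpa using h i, fun j => ?_⟩
      rcases eq_or_ne j i with rfl | hj
      · simp
      · simpa [Function.update_of_ne hj] using h j
    · rintro ⟨h₁, h₂⟩ j
      rcases eq_or_ne j i with rfl | hj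
      · simpa using h₁
      · simpa [Function.update_of_ne hj] using h₂ j
  rw [hpre, Measure.prod_prod, Measure.pi_pi, ← Finset.mul_prod_erase _ _ (Finset.mem_univ i),
    ← Finset.mul_prod_erase _ (fun j => μ j (s j)) (Finset.mem_univ i), Function.update_self,
    measure_univ, one_mul]
  congr 1
  exact Finset.prod_congr rfl fun j hj => by rw [Function.update_of_ne (Finset.ne_of_mem_erase hj)]

namespace Market.StrategyProfile

variable {k n N : ℕ} {Θ : Type*} [MeasurableSpace Θ] {S : Market k n N Θ} {M : S.Profile}
  (τ : StrategyProfile M)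

instance : IsProbabilityMeasure τ.priceLaw := by
  unfold priceLaw
  infer_instance

theorem sale_eq_one {p : Entrant M → ℝ} {i : Entrant M}
    (h : ∀ᵐ c ∂(τ.consumer p : Measure (Choice M)), i ∈ c.1) :
    (τ.consumer p : Measure (Choice M)).real {c | i ∈ c.1} = 1 := by
  have h' : {c : Choice M | i ∈ c.1} =ᵐ[(τ.consumer p : Measure (Choice M))] Set.univ :=
    Filter.eventuallyEq_univ.2 h
  rw [measureReal_congr h', probReal_univ]

variable {τ}

/-- Sure sale is known under the joint price law. Viewing coordinate `i` as an independent draw,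
Fubini transfers it to almost every fixed own price. -/
theorem BuysAll.profit_eq (hb : τ.BuysAll) (i : Entrant M) :
    ∀ᵐ x ∂(τ.price i : Measure ℝ), τ.profit i x = x - S.cost (model M i) := by
  have h := (measurePreserving_update (fun j => (τ.price j : Measure ℝ))
    i).quasiMeasurePreserving.ae hb
  filter_upwards [Measure.ae_ae_of_ae_prod h] with x hx
  unfold profit
  congr 1
  have h₁ : (fun p => x * (τ.consumer (Function.update p i x) : Measure (Choice M)).real
      {c | i ∈ c.1}) =ᵐ[τ.priceLaw] fun _ => x := by
    filter_upwards [hx] with p hp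
    rw [τ.sale_eq_one (by filter_upwards [hp] with c hc; rw [hc]; exact Finset.mem_univ i), mul_one]
  rw [integral_congr_ae h₁]
  simp

/-- If all models are sold for sure, then firms do not randomize. -/
theorem IsSPNE.exists_ae_eq (hs : τ.IsSPNE) (hb : τ.BuysAll) :
    ∃ p₀ : Entrant M → ℝ, (∀ᵐ p ∂τ.priceLaw, p = p₀) ∧
      ∀ i x, τ.profit i x ≤ p₀ i - S.cost (model M i) := by
  have h : ∀ i, ∃ x₀, (∀ᵐ x ∂(τ.price i : Measure ℝ), x = x₀) ∧
      ∀ x, τ.profit i x ≤ x₀ - S.cost (model M i) := by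
    intro i
    -- Almost all prices are best responses and earn price minus cost; equal profits force equal
    -- prices.
    obtain ⟨x₀, hx₀, hx₀e⟩ := ((hs.2 i).and (hb.profit_eq i)).exists
    refine ⟨x₀, ?_, fun x => hx₀e ▸ hx₀ x⟩
    filter_upwards [hs.2 i, hb.profit_eq i] with x hx hxe
    have h₁ := hx x₀
    have h₂ := hx₀ x
    linarith
  choose p₀ hp₀ hmax using h
  refine ⟨p₀, ?_, hmax⟩
  have h : ∀ᵐ p ∂τ.priceLaw, ∀ i, p i = p₀ i :=
    ae_all_iff.2 fun i => (Measure.quasiMeasurePreserving_eval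
      (fun j => (τ.price j : Measure ℝ)) i).ae (hp₀ i)
  filter_upwards [h] with p hp
  exact funext hp

theorem IsSPNE.ae_solvesPriceSystem (hM : FiniteMSE M) (hs : τ.IsSPNE) (hb : τ.BuysAll) :
    ∀ᵐ p ∂τ.priceLaw, SolvesPriceSystem M p := by
  obtain ⟨p, hp, hmax⟩ := hs.exists_ae_eq hb
  have hle : ∀ A, netValue (U M) p A ≤ netValue (U M) p Finset.univ := by
    obtain ⟨q, hq, hqb⟩ := (hp.and hb).exists
    subst hq
    obtain ⟨c, hc, hopt⟩ := (hqb.and (hs.1 q)).exists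
    intro A
    rw [← hc]
    exact netValue_le_of_optimal hM hopt A
  suffices h : SolvesPriceSystem M p by
    filter_upwards [hp] with q hq
    rwa [hq]
  refine (solvesPriceSystem_iff p).2 fun i => ⟨fun A _ => hle A, ?_⟩
  by_contra! hi
  obtain ⟨A₀, hA₀, hA₀max⟩ := Finset.exists_max_image
    (Finset.univ.filter fun A : Finset (Entrant M) => i ∉ A) (netValue (U M) p) ⟨∅, by simp⟩
  have hA₀i : i ∉ A₀ := by simpa using hA₀
  have hlt := lt_of_le_of_ne (hle A₀) (hi A₀ hA₀i)
  -- Staying strictly inside the slack makes every set omitting `i` strictly worse than the full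
  -- set, so `i` sells however the consumer breaks ties.
  obtain ⟨δ, hδ, hδ'⟩ := exists_between (sub_pos.2 hlt)
  have hsale : ∀ᵐ c ∂(τ.consumer (Function.update p i (p i + δ)) : Measure (Choice M)),
      i ∈ c.1 := by
    filter_upwards [hs.1 (Function.update p i (p i + δ))] with c hc
    by_contra hic
    have h₁ := netValue_le_of_optimal hM hc Finset.univ
    rw [netValue_update_of_mem _ _ _ (Finset.mem_univ i), netValue_update_of_notMem _ _ _ hic] at h₁
    have h₂ := hA₀max c.1 (by simpa using hic)
    linarith
  have hprofit : τ.profit i (p i + δ) = p i + δ - S.cost (model M i) := by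
    unfold profit
    congr 1
    have h₁ : (fun q => (p i + δ) * (τ.consumer (Function.update q i (p i + δ)) :
        Measure (Choice M)).real {c | i ∈ c.1}) =ᵐ[τ.priceLaw] fun _ => p i + δ := by
      filter_upwards [hp] with q hq
      rw [hq, τ.sale_eq_one hsale, mul_one]
    rw [integral_congr_ae h₁]
    simp
  have := hmax i (p i + δ)
  linarith

end Market.StrategyProfile

end ModelMarket

theorem proposition1 {k n N : ℕ} {Θ : Type*} [MeasurableSpace Θ]
    (S : ModelMarket.Market k n N Θ) (M : S.Profile)
    (hM : ModelMarket.Market.FiniteMSE M) :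
    -- existence, when buying all models is worth at least the outside option
    (S.outside ≤ ModelMarket.Market.U M Finset.univ →
      ∃ (p : ModelMarket.Market.Entrant M → ℝ) (τ : ModelMarket.Market.StrategyProfile M),
        ModelMarket.Market.SolvesPriceSystem M p ∧ (∀ i, 0 ≤ p i) ∧
        τ.IsPureWithPrices p ∧ τ.IsSPNE ∧ τ.BuysAll) ∧
    -- all solutions, when each single model is worth at least the outside option
    ((∀ i : ModelMarket.Market.Entrant M, S.outside ≤ ModelMarket.Market.U M {i}) →
      ∀ p : ModelMarket.Market.Entrant M → ℝ, ModelMarket.Market.SolvesPriceSystem M p →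
        (∀ i, 0 ≤ p i) ∧
        ∃ τ : ModelMarket.Market.StrategyProfile M,
          τ.IsPureWithPrices p ∧ τ.IsSPNE ∧ τ.BuysAll) ∧
    -- necessity, without any condition on the outside option
    (∀ τ : ModelMarket.Market.StrategyProfile M, τ.IsSPNE → τ.BuysAll →
      ∀ᵐ p ∂τ.priceLaw, ModelMarket.Market.SolvesPriceSystem M p) := by
  refine ⟨fun hU => ?_, fun hU p hp => ?_, fun τ hs hb => hs.ae_solvesPriceSystem hM hb⟩
  · have hV : ∀ A, ModelMarket.Market.U M A ≤ ModelMarket.Market.U M Finset.univ := by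
      intro A
      rcases A.eq_empty_or_nonempty with rfl | hA
      · simpa [ModelMarket.Market.U] using hU
      · exact ModelMarket.Market.U_mono hM hA (Finset.subset_univ A)
    obtain ⟨p, h₀, hle, hi⟩ := ModelMarket.exists_prices (ModelMarket.Market.U M) hV
    have hp : ModelMarket.Market.SolvesPriceSystem M p :=
      (ModelMarket.Market.solvesPriceSystem_iff p).2 fun i => ⟨fun A _ => hle A, hi i⟩
    obtain ⟨τ, hτ⟩ := hp.exists_isSPNE hM h₀
    exact ⟨p, τ, hp, h₀, hτ⟩
  · have hV : ∀ i A, ModelMarket.Market.U M A ≤ ModelMarket.Market.U M (insert i A) := by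
      intro i A
      rcases A.eq_empty_or_nonempty with rfl | hA
      -- Only the step from the empty set needs the outside-option hypothesis.
      · rw [insert_empty_eq]
        simpa only [ModelMarket.Market.U, if_true] using hU i
      · exact ModelMarket.Market.U_mono hM hA (Finset.subset_insert i A)
    have h₀ : ∀ i, 0 ≤ p i := fun i => ModelMarket.prices_nonneg (ModelMarket.Market.U M) p hV
      hp.netValue_le ((ModelMarket.Market.solvesPriceSystem_iff p).1 hp i).2
    exact ⟨h₀, hp.exists_isSPNE hM h₀⟩
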